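/- Let $K$ be an algebraically closed field, let $Q$ be a quiver with finite vertex set $Q_0$ and set of arrows $Q_1$, let $I$ be an admissible ideal of the path algebra $KQ$ (that is, $(KQ_{\ge 1})^m\subseteq I\subseteq (KQ_{\ge 1})^2$ for some $m\ge 2$, where $KQ_{\ge 1}$ is the ideal generated by the arrows), and suppose that $A=KQ/I$ is finite dimensional. Let $\mathcal B$ be a set of paths in $Q$ whose images form a $K$-basis of $A$. For a vertex $e$ write $e$ also for the corresponding idempotent of $KQ$ and of $A$. Let $\operatorname{Ker}(\delta^1)$ be the space of all maps $f\colon Q_1\to A$ with $f(\alpha)\in eAe'$ for every arrow $\alpha$ from $e$ to $e'$ (paths are composed from left to right), such that for every $r=\sum_q\lambda_q q\in I$ one has $\sum_q\lambda_q\, q^{(f)}=0$ in $A$, where, for a path $q=\alpha_1\cdots\alpha_n$, $q^{(f)}=\sum_{l=1}^n \alpha_1\cdots\alpha_{l-1}f(\alpha_l)\alpha_{l+1}\cdots\alpha_n$. (These $f$ are the restrictions to the arrows of the $K$-linear derivations of $A$ that vanish on $Q_0$.) Let $\Sigma_0(A)$ be the set of pairs $(\alpha,e)$, where $e\in\mathcal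 B$ is a vertex and $\alpha$ is a loop at $e$, such that for some $f\in\operatorname{Ker}(\delta^1)$ the coefficient of $e$ in the expansion of $f(\alpha)$ in the basis $\mathcal B$ is nonzero. Suppose that $\dim_K\operatorname{Ext}^1_A(S,T)\le 1$ for all simple right $A$-modules $S$ and $T$ (including $S=T$), and that $\Sigma_0(A)=\emptyset$. Then the Lie algebra $\mathrm{HH}^1(A)=\operatorname{Der}_K(A)/\operatorname{Inn}(A)$, with the bracket induced by the commutator of derivations, is solvable. -/

import Mathlib

/-! ## Path algebras -/

universe u v w

/-- Paths in a quiver with arbitrary endpoints; `⟨i, j, p⟩` is a path `p` from `i` to `j`. -/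
abbrev QPath (Q : Type u) [Quiver.{v + 1} Q] : Type (max u (v + 1)) := Σ i j : Q, Quiver.Path i j

/-- The underlying vector space of the path algebra `KQ`: the paths form a basis. -/
def PathAlgebra (K : Type w) (Q : Type u) [Field K] [Quiver.{v + 1} Q] : Type (max u (v + 1) w) :=
  QPath.{u, v} Q →₀ K

namespace PathAlgebra

section

variable (K : Type w) {Q : Type u} [Field K] [Quiver.{v + 1} Q]

noncomputable instance : AddCommGroup (PathAlgebra K Q) :=
  inferInstanceAs (AddCommGroup (QPath Q →₀ K))

noncomputable instance : Module K (PathAlgebra K Q) :=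
  inferInstanceAs (Module K (QPath Q →₀ K))

/-- The basis element of `KQ` given by a path. -/
noncomputable def ofPath {i j : Q} (p : Quiver.Path i j) : PathAlgebra K Q :=
  Finsupp.single (⟨i, j, p⟩ : QPath Q) (1 : K)

/-- The idempotent of `KQ` given by a vertex (the path of length zero). -/
noncomputable def vertex (i : Q) : PathAlgebra K Q := ofPath K (Quiver.Path.nil : Quiver.Path i i)

/-- The element of `KQ` given by an arrow. -/
noncomputable def arrow {i j : Q} (a : i ⟶ j) : PathAlgebra K Q := ofPath K a.toPath

/-- The linear extension to `KQ` of a map defined on paths. -/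
noncomputable def lift {M : Type*} [AddCommGroup M] [Module K M] (f : QPath Q → M) :
    PathAlgebra K Q →ₗ[K] M :=
  Finsupp.linearCombination K f

open Classical in
/-- The product of two paths: first `p`, then `q` if `p` ends where `q` starts, and `0` if not. -/
noncomputable def pathMul (p q : QPath Q) : PathAlgebra K Q :=
  if h : p.2.1 = q.1 then ofPath K (p.2.2.comp (q.2.2.cast h.symm rfl)) else 0

/-- The bilinear multiplication of `KQ`. -/
noncomputable def mulHom : PathAlgebra K Q →ₗ[K] PathAlgebra K Q →ₗ[K] PathAlgebra K Q :=
  lift K fun p => lift K fun q => pathMul K p q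

variable {K}

@[simp] theorem lift_ofPath {M : Type*} [AddCommGroup M] [Module K M] (f : QPath Q → M)
    {i j : Q} (p : Quiver.Path i j) : lift K f (ofPath K p) = f ⟨i, j, p⟩ :=
  (Finsupp.linearCombination_single K (1 : K) (⟨i, j, p⟩ : QPath Q)).trans (one_smul K _)

theorem hom_ext {M : Type*} [AddCommGroup M] [Module K M] {f g : PathAlgebra K Q →ₗ[K] M}
    (h : ∀ (i j : Q) (p : Quiver.Path i j), f (ofPath K p) = g (ofPath K p)) : f = g :=
  Finsupp.lhom_ext' fun ⟨i, j, p⟩ => LinearMap.ext_ring (h i j p)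

@[simp] theorem mulHom_comp {i j k : Q} (p : Quiver.Path i j) (q : Quiver.Path j k) :
    mulHom K (ofPath K p) (ofPath K q) = ofPath K (p.comp q) := by
  simp [mulHom, pathMul]

theorem mulHom_of_ne {i j j' k : Q} (p : Quiver.Path i j) (q : Quiver.Path j' k) (h : j ≠ j') :
    mulHom K (ofPath K p) (ofPath K q) = 0 := by
  simp [mulHom, pathMul, h]

theorem mulHom_assoc (x y z : PathAlgebra K Q) :
    mulHom K (mulHom K x y) z = mulHom K x (mulHom K y z) := by
  have h1 : ∀ (i j : Q) (p : Quiver.Path i j) (k l : Q) (q : Quiver.Path k l)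
      (m n : Q) (r : Quiver.Path m n),
      mulHom K (mulHom K (ofPath K p) (ofPath K q)) (ofPath K r) =
        mulHom K (ofPath K p) (mulHom K (ofPath K q) (ofPath K r)) := by
    intro i j p k l q m n r
    by_cases hjk : j = k
    · subst hjk
      by_cases hlm : l = m
      · subst hlm
        simp
      · rw [mulHom_comp, mulHom_of_ne _ _ hlm, mulHom_of_ne _ _ hlm, map_zero]
    · rw [mulHom_of_ne _ _ hjk, map_zero, LinearMap.zero_apply]
      by_cases hlm : l = m
      · subst hlm
        rw [mulHom_comp, mulHom_of_ne _ _ hjk]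
      · rw [mulHom_of_ne _ _ hlm, map_zero]
  have h2 : ∀ (i j : Q) (p : Quiver.Path i j) (k l : Q) (q : Quiver.Path k l)
      (z : PathAlgebra K Q),
      mulHom K (mulHom K (ofPath K p) (ofPath K q)) z =
        mulHom K (ofPath K p) (mulHom K (ofPath K q) z) := by
    intro i j p k l q z
    exact LinearMap.congr_fun (f := mulHom K (mulHom K (ofPath K p) (ofPath K q)))
      (g := (mulHom K (ofPath K p)).comp (mulHom K (ofPath K q)))
      (hom_ext fun m n r => h1 i j p k l q m n r) z
  have h3 : ∀ (i j : Q) (p : Quiver.Path i j) (y z : PathAlgebra K Q),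
      mulHom K (mulHom K (ofPath K p) y) z = mulHom K (ofPath K p) (mulHom K y z) := by
    intro i j p y z
    exact LinearMap.congr_fun (f := ((mulHom K).flip z).comp (mulHom K (ofPath K p)))
      (g := (mulHom K (ofPath K p)).comp ((mulHom K).flip z))
      (hom_ext fun k l q => h2 i j p k l q z) y
  exact LinearMap.congr_fun (f := ((mulHom K).flip z).comp ((mulHom K).flip y))
    (g := (mulHom K).flip (mulHom K y z)) (hom_ext fun i j p => h3 i j p y z) x

variable [Fintype Q]

theorem one_mulHom (x : PathAlgebra K Q) : mulHom K (∑ i : Q, vertex K i) x = x := by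
  refine LinearMap.congr_fun (f := mulHom K (∑ i : Q, vertex K i)) (g := LinearMap.id)
    (hom_ext fun i j p => ?_) x
  rw [map_sum, LinearMap.sum_apply, Finset.sum_eq_single i]
  · simp [vertex]
  · intro k _ hk
    exact mulHom_of_ne _ _ hk
  · simp

theorem mulHom_one (x : PathAlgebra K Q) : mulHom K x (∑ i : Q, vertex K i) = x := by
  refine LinearMap.congr_fun (f := (mulHom K).flip (∑ i : Q, vertex K i)) (g := LinearMap.id)
    (hom_ext fun i j p => ?_) x
  rw [LinearMap.flip_apply, map_sum, Finset.sum_eq_single j]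
  · simp [vertex]
  · intro k _ hk
    exact mulHom_of_ne _ _ hk.symm
  · simp

noncomputable instance : Ring (PathAlgebra K Q) :=
  { (inferInstance : AddCommGroup (PathAlgebra K Q)) with
    mul := fun x y => mulHom K x y
    one := ∑ i : Q, vertex K i
    left_distrib := fun x y z => map_add (mulHom K x) y z
    right_distrib := fun x y z => LinearMap.map_add₂ (mulHom K) x y z
    zero_mul := fun x => LinearMap.map_zero₂ (mulHom K) x
    mul_zero := fun x => map_zero (mulHom K x)
    mul_assoc := mulHom_assoc
    one_mul := one_mulHom
    mul_one := mulHom_one }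

noncomputable instance : Algebra K (PathAlgebra K Q) :=
  Algebra.ofModule (fun r x y => LinearMap.map_smul₂ (mulHom K) r x y)
    (fun r x y => map_smul (mulHom K x) r y)

end

/-- The `m`-th power of the arrow ideal of `KQ`: the span of the paths of length at least `m`. -/
noncomputable def arrowIdealPow (K : Type w) (Q : Type u) [Field K] [Quiver.{v + 1} Q] (m : ℕ) :
    Submodule K (PathAlgebra K Q) :=
  Submodule.span K {x | ∃ (i j : Q) (p : Quiver.Path i j), m ≤ p.length ∧ x = ofPath K p}

end PathAlgebra

/-! ## Presentations `A = KQ/I` and the sets `Σ_n(A)` -/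

section Presentation

variable {K : Type*} {Q : Type u} {A : Type*} [Field K] [Quiver.{v + 1} Q] [Fintype Q] [Ring A]
  [Algebra K A] (π : PathAlgebra K Q →ₐ[K] A)

/-- `π` presents `A` as `KQ/I`, where the ideal `I = ker π` is admissible: it is contained in the
square of the arrow ideal and contains some power of the arrow ideal. -/
structure IsAdmissiblePresentation : Prop where
  surjective : Function.Surjective π
  ker_le : ∀ x, π x = 0 → x ∈ PathAlgebra.arrowIdealPow K Q 2
  le_ker : ∃ m, 2 ≤ m ∧ ∀ x ∈ PathAlgebra.arrowIdealPow K Q m, π x = 0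

/-- A `K`-basis of `A = KQ/I` that consists of the images of the paths in the set `B`. -/
structure PathBasis (B : Set (QPath Q)) where
  basis : Module.Basis B K A
  basis_apply : ∀ p : B, basis p = π (PathAlgebra.ofPath K p.1.2.2)

/-- The elements of `Hom_{E⊗Eᵒᵖ}(KQ₁, A)`, which is `K(Q₁ ‖ B)` for a path basis `B`: maps that send
every arrow `a : i ⟶ j` to an element of `e_i A e_j`. -/
def IsOneCochain (f : ∀ ⦃i j : Q⦄, (i ⟶ j) → A) : Prop :=
  ∀ (i j : Q) (a : i ⟶ j), π (PathAlgebra.vertex K i) * f a * π (PathAlgebra.vertex K j) = f a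

/-- For a path `p = a₁⋯aₙ`, the sum over `l` of the elements `a₁⋯f(a_l)⋯aₙ` of `A` obtained by
replacing one arrow of the path by its image under `f`. -/
noncomputable def replaceOnPath (f : ∀ ⦃i j : Q⦄, (i ⟶ j) → A) {i : Q} :
    ∀ {j : Q}, Quiver.Path i j → A
  | _, .nil => 0
  | _, .cons p a => replaceOnPath f p * π (PathAlgebra.arrow K a) + π (PathAlgebra.ofPath K p) * f a

/-- The value `δ¹(f)(r)` of the differential at an element `r` of `KQ`, the linear extension of
`replaceOnPath`. -/
noncomputable def deltaOne (f : ∀ ⦃i j : Q⦄, (i ⟶ j) → A) : PathAlgebra K Q →ₗ[K] A :=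
  PathAlgebra.lift K fun p => replaceOnPath π f p.2.2

/-- The kernel of `δ¹`: cochains `f` such that `δ¹(f)` vanishes on all relations `r ∈ I`. -/
def IsOneCocycle (f : ∀ ⦃i j : Q⦄, (i ⟶ j) → A) : Prop :=
  IsOneCochain π f ∧ ∀ r, π r = 0 → deltaOne π f r = 0

/-- `Σ_n(A)`: the pairs `a ‖ p` of an arrow `a` and a parallel path `p ∈ B` of length `n` that occur
with a nonzero coefficient in some element of the kernel of `δ¹`. -/
def SigmaSet {B : Set (QPath Q)} (b : PathBasis π B) (n : ℕ) :
    Set (Σ i j : Q, (i ⟶ j) × Quiver.Path i j) :=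
  {x | x.2.2.2.length = n ∧ ∃ hB : (⟨x.1, x.2.1, x.2.2.2⟩ : QPath Q) ∈ B,
    ∃ f : ∀ ⦃i j : Q⦄, (i ⟶ j) → A, IsOneCocycle π f ∧ b.basis.repr (f x.2.2.1) ⟨_, hB⟩ ≠ 0}

end Presentation

/-! ## The Lie algebra `HH¹(A)` -/

section Hochschild

attribute [local instance] LieRing.ofAssociativeRing

variable (K : Type*) (A : Type*) [Field K] [Ring A] [Algebra K A]

/-- The Lie algebra `Der_K(A)` of `K`-linear derivations of the algebra `A`, with the commutator of
linear endomorphisms as its bracket. -/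
def algDer : LieSubalgebra K (Module.End K A) where
  carrier := {D | ∀ x y : A, D (x * y) = D x * y + x * D y}
  add_mem' := by
    intro D D' h h' x y
    simp only [LinearMap.add_apply, h x y, h' x y]
    noncomm_ring
  zero_mem' := by intro x y; simp
  smul_mem' := by
    intro c D h x y
    simp only [LinearMap.smul_apply, h x y, smul_add, smul_mul_assoc, mul_smul_comm]
  lie_mem' := by
    intro D D' h h' x y
    have h : ∀ x y : A, D (x * y) = D x * y + x * D y := h
    have h' : ∀ x y : A, D' (x * y) = D' x * y + x * D' y := h'
    simp only [Ring.lie_def, LinearMap.sub_apply, Module.End.mul_apply, h, h', map_add]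
    noncomm_ring

/-- The Lie ideal of inner derivations `x ↦ a * x - x * a`. -/
def innerDer : LieIdeal K (algDer K A) where
  carrier := {D | ∃ a : A, ∀ x : A, D.1 x = a * x - x * a}
  add_mem' := by
    rintro D D' ⟨a, h⟩ ⟨a', h'⟩
    refine ⟨a + a', fun x => ?_⟩
    have : (D + D').1 x = D.1 x + D'.1 x := rfl
    rw [this, h, h']
    noncomm_ring
  zero_mem' := ⟨0, fun x => by simp⟩
  smul_mem' := by
    rintro c D ⟨a, h⟩
    refine ⟨c • a, fun x => ?_⟩
    have : (c • D).1 x = c • D.1 x := rfl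
    rw [this, h, smul_sub, smul_mul_assoc, mul_smul_comm]
  lie_mem := by
    rintro D D' ⟨a, h⟩
    refine ⟨D.1 a, fun x => ?_⟩
    have e : ⁅D, D'⁆.1 x = D.1 (D'.1 x) - D'.1 (D.1 x) := rfl
    have hD : ∀ x y : A, D.1 (x * y) = D.1 x * y + x * D.1 y := D.2
    rw [e, h, h, map_sub, hD, hD]
    noncomm_ring

/-- The first Hochschild cohomology `HH¹(A) = Der_K(A)/Inn(A)`. -/
def HochschildOne : Type _ := algDer K A ⧸ innerDer K A

noncomputable instance : LieRing (HochschildOne K A) :=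
  inferInstanceAs (LieRing (algDer K A ⧸ innerDer K A))

noncomputable instance : LieAlgebra K (HochschildOne K A) :=
  inferInstanceAs (LieAlgebra K (algDer K A ⧸ innerDer K A))

end Hochschild

/-! Let `J` be the image of the arrow ideal in `A`, and `L` the Lie algebra of derivations that
vanish on the vertices. Subtracting an inner derivation moves any derivation into `L`
(`exists_vertexDer_sub_mem_innerDer`), so `HH¹(A)` is a quotient of `L`, and it suffices that `L` is
solvable.

Elements of `L` restrict to cocycles on the arrows, so `Σ₀(A) = ∅` forces them to map arrows into
`J` (`vertexDer_arrow_mem`). Hence `L` is filtered by the ideals `L_k` of derivations that send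
arrows to `J^(1+k)`. By the Leibniz rule `[L_k, L_k] ⊆ L_{2k}`, which lies in `L_{k+1}` once `k ≥
1`, and `L_k = 0` for large `k` because `J` is nilpotent.

Only `[L_0, L_0] ⊆ L_1` needs the `Ext` bound. Distinct parallel arrows from `i` to `j` give
independent classes in `Ext¹(S_i, S_j)`, so there are none (`subsingleton_arrows`). Then `L` acts on
`J/J²` by scalars on each arrow, and scalars commute (`vertexDer_lie_mem`). -/

/-! ## Lower bound for `Ext¹` between one-dimensional modules -/

section ExtOneDimensional

open CategoryTheory MulOpposite

variable {K : Type*} {A : Type w} [Field K] [Ring A] [Algebra K A]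

/-- The kernel of a character of `A`, as a left ideal of the opposite algebra. -/
def characterIdeal (χ : A →ₐ[K] K) : Ideal Aᵐᵒᵖ :=
  RingHom.ker (χ.toRingHom.fromOpposite fun _ _ => mul_comm _ _)

theorem mem_characterIdeal (χ : A →ₐ[K] K) (x : Aᵐᵒᵖ) :
    x ∈ characterIdeal χ ↔ χ x.unop = 0 := Iff.rfl

/-- The one-dimensional right `A`-module given by a character of `A`. -/
abbrev RightCharacterModule (χ : A →ₐ[K] K) : Type w := Aᵐᵒᵖ ⧸ characterIdeal χ

theorem isSimpleModule_characterModule (χ : A →ₐ[K] K) :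
    IsSimpleModule Aᵐᵒᵖ (RightCharacterModule χ) := by
  refine isSimpleModule_iff_isCoatom.mpr (RingHom.ker_isMaximal_of_surjective _ ?_).out
  intro c
  refine ⟨op (algebraMap K A c), ?_⟩
  exact χ.commutes c

theorem characterModule_mk_eq (χ : A →ₐ[K] K) (x y : Aᵐᵒᵖ) :
    (characterIdeal χ).mkQ x = (characterIdeal χ).mkQ y ↔ χ x.unop = χ y.unop := by
  rw [← sub_eq_zero, ← map_sub, Submodule.mkQ_apply, Submodule.Quotient.mk_eq_zero,
    mem_characterIdeal, MulOpposite.unop_sub, map_sub, sub_eq_zero]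

/-- A `(χ, χ')`-derivation `c` of `A` restricts to a homomorphism of right modules from the kernel
of `χ` to the one-dimensional module given by `χ'`. -/
def characterHom (χ χ' : A →ₐ[K] K) (c : A →ₗ[K] K)
    (hc : ∀ x y, c (x * y) = χ x * c y + c x * χ' y) :
    LinearMap.ker (characterIdeal χ).mkQ →ₗ[Aᵐᵒᵖ] RightCharacterModule χ' where
  toFun y := (characterIdeal χ').mkQ (op (algebraMap K A (c y.1.unop)))
  map_add' y z := by simp
  map_smul' r y := by
    -- This kills the term `χ y * c r` of the twisted Leibniz rule; what remains is right linearity.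
    have hy : χ y.1.unop = 0 := (SetLike.ext_iff.mp (Submodule.ker_mkQ _) y.1).mp y.2
    rw [RingHom.id_apply, ← map_smul, characterModule_mk_eq]
    simp [hc, hy]

/-- The sequence `0 → ker χ → A → S → 0` gives a connecting map `Hom(ker χ, S') → Ext¹(S, S')` that
kills only the maps extending to `A`. A map defined on `A` is determined by the image of `1`, so it
vanishes wherever `χ'` does; evaluating at `x` and `x'` shows that no nontrivial combination of the
maps given by `c` and `c'` extends. -/
theorem one_lt_rank_ext_characterModule (χ χ' : A →ₐ[K] K) (c c' : A →ₗ[K] K)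
    (hc : ∀ x y, c (x * y) = χ x * c y + c x * χ' y)
    (hc' : ∀ x y, c' (x * y) = χ x * c' y + c' x * χ' y) {x x' : A}
    (hx : χ x = 0) (hx' : χ x' = 0) (hxχ : χ' x = 0) (hxχ' : χ' x' = 0)
    (hcx : c x = 1) (hcx' : c x' = 0) (hc'x : c' x = 0) (hc'x' : c' x' = 1) :
    ¬ Module.rank K (Abelian.Ext (ModuleCat.of Aᵐᵒᵖ (RightCharacterModule χ))
      (ModuleCat.of Aᵐᵒᵖ (RightCharacterModule χ')) 1) ≤ 1 := by
  intro hle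
  have hS := LinearMap.shortExact_shortComplexKer (characterIdeal χ).mkQ_surjective
  let φ := ModuleCat.ofHom (characterHom χ χ' c hc)
  let φ' := ModuleCat.ofHom (characterHom χ χ' c' hc')
  have key : ∀ s t : K, s • hS.extClass.comp (Abelian.Ext.mk₀ φ) (add_zero 1) +
      t • hS.extClass.comp (Abelian.Ext.mk₀ φ') (add_zero 1) = 0 → s = 0 ∧ t = 0 := by
    intro s t h
    rw [← Abelian.Ext.comp_smul, ← Abelian.Ext.comp_smul, ← Abelian.Ext.comp_add,
      ← Abelian.Ext.mk₀_smul, ← Abelian.Ext.mk₀_smul, ← Abelian.Ext.mk₀_add] at h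
    -- Exactness: the combined homomorphism on `ker χ` extends to a homomorphism `g` on `A`.
    obtain ⟨g, hg⟩ := Abelian.Ext.contravariant_sequence_exact₁ hS _ _ _ h
    obtain ⟨g, rfl⟩ := (Abelian.Ext.mk₀_bijective _ _).2 g
    rw [Abelian.Ext.mk₀_comp_mk₀] at hg
    have hg := (Abelian.Ext.mk₀_bijective _ _).1 hg
    have hev : ∀ y : A, χ y = 0 → χ' y = 0 → s * c y + t * c' y = 0 := by
      intro y hy hy'
      have hmem : op y ∈ LinearMap.ker (characterIdeal χ).mkQ := by
        rwa [Submodule.ker_mkQ]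
      have h1 := congrArg (fun f => f.hom ⟨op y, hmem⟩) hg
      have h2 : g.hom (op y) = algebraMap K Aᵐᵒᵖ s • (characterIdeal χ').mkQ
          (op (algebraMap K A (c y))) + algebraMap K Aᵐᵒᵖ t • (characterIdeal χ').mkQ
          (op (algebraMap K A (c' y))) := h1
      obtain ⟨u, hu⟩ := (characterIdeal χ').mkQ_surjective (g.hom (1 : Aᵐᵒᵖ))
      have h3 : g.hom (op y) = op y • (characterIdeal χ').mkQ u := by
        rw [hu, ← map_smul, smul_eq_mul, mul_one]
      rw [h3, ← map_smul, ← map_smul, ← map_smul, ← map_add, characterModule_mk_eq] at h2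
      simpa [hy', mul_comm, eq_comm] using h2
    have h1 := hev x hx hxχ
    have h2 := hev x' hx' hxχ'
    rw [hcx, hc'x] at h1
    rw [hcx', hc'x'] at h2
    constructor
    · simpa using h1
    · simpa using h2
  obtain ⟨v, hv⟩ := rank_le_one_iff.mp hle
  obtain ⟨s, hs⟩ := hv (hS.extClass.comp (Abelian.Ext.mk₀ φ) (add_zero 1))
  obtain ⟨t, ht⟩ := hv (hS.extClass.comp (Abelian.Ext.mk₀ φ') (add_zero 1))
  -- If the two classes are `s • v` and `t • v`, then `t` times the first minus `s` times the second
  -- is zero. This gives `s = 0`, so the first class vanishes, against `key 1 0`.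
  have h1 := key t (-s) (by
    rw [← hs, ← ht, smul_smul, smul_smul, neg_mul, mul_comm s t, neg_smul, add_neg_cancel])
  have h2 := key 1 0 (by
    rw [zero_smul, add_zero, one_smul, ← hs, neg_eq_zero.mp h1.2, zero_smul])
  exact one_ne_zero h2.1

end ExtOneDimensional

/-! ## Coefficients of vertices and arrows -/

namespace PathAlgebra

section Coefficients

variable (K : Type w) {Q : Type u} [Field K] [Quiver.{v + 1} Q]

open Classical in
/-- The coefficient of the vertex `e` in a path. -/
noncomputable def vertexCoeff (e : Q) : ∀ {i j : Q}, Quiver.Path i j → K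
  | i, _, .nil => if i = e then 1 else 0
  | _, _, .cons _ _ => 0

open Classical in
/-- The coefficient of the arrow `x` in a path. -/
noncomputable def arrowCoeff (x : Σ i j : Q, (i ⟶ j)) : ∀ {i j : Q}, Quiver.Path i j → K
  | _, _, .nil => 0
  | _, _, .cons (b := k) (c := j) p a => if p.length = 0 ∧ ⟨k, j, a⟩ = x then 1 else 0

variable {K}

/-- A composite has length zero only if both factors do; this multiplicativity makes the coefficient
of a vertex a character. -/
theorem vertexCoeff_comp (e : Q) {i j k : Q} (p : Quiver.Path i j) (q : Quiver.Path j k) :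
    vertexCoeff K e (p.comp q) = vertexCoeff K e p * vertexCoeff K e q := by
  cases q with
  | cons q a => simp [vertexCoeff]
  | nil =>
    cases p with
    | cons p a => simp [vertexCoeff]
    | nil => simp [vertexCoeff]

theorem vertexCoeff_mul_of_ne (e : Q) {i j j' k : Q} (p : Quiver.Path i j) (q : Quiver.Path j' k)
    (h : j ≠ j') : vertexCoeff K e p * vertexCoeff K e q = 0 := by
  cases q with
  | cons q a => simp [vertexCoeff]
  | nil =>
    cases p with
    | cons p a => simp [vertexCoeff]
    | nil =>
      by_cases h1 : i = e
      · simp [vertexCoeff, h1 ▸ h.symm]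
      · simp [vertexCoeff, h1]

/-- A composite is a single arrow only if one factor is that arrow and the other is the trivial path
at its source or target. This yields the derivations that feed `characterHom`. -/
theorem arrowCoeff_comp (x : Σ i j : Q, (i ⟶ j)) {i j k : Q} (p : Quiver.Path i j)
    (q : Quiver.Path j k) : arrowCoeff K x (p.comp q) =
      vertexCoeff K x.1 p * arrowCoeff K x q + arrowCoeff K x p * vertexCoeff K x.2.1 q := by
  cases q with
  | nil =>
    cases p with
    | nil => simp [arrowCoeff]
    | cons p a =>
      by_cases h : p.length = 0 ∧ (⟨_, _, a⟩ : Σ i j : Q, (i ⟶ j)) = x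
      · obtain ⟨h1, rfl⟩ := h
        simp [arrowCoeff, vertexCoeff]
      · simp [arrowCoeff, h]
  | cons q a =>
    cases p with
    | cons p a => simp [arrowCoeff, vertexCoeff]
    | nil =>
      by_cases h : q.length = 0 ∧ (⟨_, _, a⟩ : Σ i j : Q, (i ⟶ j)) = x
      · obtain ⟨h1, rfl⟩ := h
        obtain rfl := Quiver.Path.eq_of_length_zero q h1
        simp [arrowCoeff, vertexCoeff]
      · simp [arrowCoeff, h]

theorem arrowCoeff_mul_of_ne (x : Σ i j : Q, (i ⟶ j)) {i j j' k : Q} (p : Quiver.Path i j)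
    (q : Quiver.Path j' k) (h : j ≠ j') :
    vertexCoeff K x.1 p * arrowCoeff K x q + arrowCoeff K x p * vertexCoeff K x.2.1 q = 0 := by
  have h1 : vertexCoeff K x.1 p * arrowCoeff K x q = 0 := by
    cases p with
    | cons p a => simp [vertexCoeff]
    | nil =>
      cases q with
      | nil => simp [arrowCoeff]
      | cons q a =>
        by_cases h' : q.length = 0 ∧ (⟨_, _, a⟩ : Σ i j : Q, (i ⟶ j)) = x
        · obtain ⟨h1, rfl⟩ := h'
          obtain rfl := Quiver.Path.eq_of_length_zero q h1
          simp [vertexCoeff, h]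
        · simp [arrowCoeff, h']
  have h2 : arrowCoeff K x p * vertexCoeff K x.2.1 q = 0 := by
    cases q with
    | cons q a => simp [vertexCoeff]
    | nil =>
      cases p with
      | nil => simp [arrowCoeff]
      | cons p a =>
        by_cases h' : p.length = 0 ∧ (⟨_, _, a⟩ : Σ i j : Q, (i ⟶ j)) = x
        · obtain ⟨h1, rfl⟩ := h'
          simp [vertexCoeff, h.symm]
        · simp [arrowCoeff, h']
  rw [h1, h2, add_zero]

theorem vertexCoeff_eq_zero (e : Q) {i j : Q} (p : Quiver.Path i j) (h : 1 ≤ p.length) :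
    vertexCoeff K e p = 0 := by
  cases p with
  | nil => simp at h
  | cons p a => rfl

theorem arrowCoeff_eq_zero (x : Σ i j : Q, (i ⟶ j)) {i j : Q} (p : Quiver.Path i j)
    (h : 2 ≤ p.length) : arrowCoeff K x p = 0 := by
  cases p with
  | nil => rfl
  | cons p a =>
    have : p.length ≠ 0 := by
      rw [Quiver.Path.length_cons] at h
      omega
    simp [arrowCoeff, this]

theorem lift_eq_zero_of_mem_arrowIdealPow {M : Type*} [AddCommGroup M] [Module K M]
    (f : QPath Q → M) {n : ℕ} (hf : ∀ (i j : Q) (p : Quiver.Path i j), n ≤ p.length →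
      f ⟨i, j, p⟩ = 0) {x : PathAlgebra K Q} (hx : x ∈ arrowIdealPow K Q n) :
    lift K f x = 0 := by
  have : arrowIdealPow K Q n ≤ LinearMap.ker (lift K f) := by
    refine Submodule.span_le.mpr ?_
    rintro _ ⟨i, j, p, hp, rfl⟩
    simpa using hf i j p hp
  exact this hx

variable [Fintype Q]

theorem one_def : (1 : PathAlgebra K Q) = ∑ i : Q, vertex K i := rfl

theorem ofPath_mul_ofPath {i j k : Q} (p : Quiver.Path i j) (q : Quiver.Path j k) :
    ofPath K p * ofPath K q = ofPath K (p.comp q) := mulHom_comp p q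

theorem ofPath_mul_of_ne {i j j' k : Q} (p : Quiver.Path i j) (q : Quiver.Path j' k)
    (h : j ≠ j') : ofPath K p * ofPath K q = 0 := mulHom_of_ne p q h

/-- A bilinear identity in the path algebra holds if it holds for paths. -/
theorem bilin_ext {M : Type*} [AddCommGroup M] [Module K M]
    {f g : PathAlgebra K Q →ₗ[K] PathAlgebra K Q →ₗ[K] M}
    (h : ∀ (i j : Q) (p : Quiver.Path i j) (k l : Q) (q : Quiver.Path k l),
      f (ofPath K p) (ofPath K q) = g (ofPath K p) (ofPath K q)) : f = g :=
  hom_ext fun i j p => hom_ext fun k l q => h i j p k l q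

theorem lift_vertexCoeff_mul (e : Q) (x y : PathAlgebra K Q) :
    lift K (fun p => vertexCoeff K e p.2.2) (x * y) =
      lift K (fun p => vertexCoeff K e p.2.2) x * lift K (fun p => vertexCoeff K e p.2.2) y := by
  let c : PathAlgebra K Q →ₗ[K] K := lift K (fun p => vertexCoeff K e p.2.2)
  have : (mulHom K).compr₂ c = (LinearMap.mul K K).compl₁₂ c c := by
    refine bilin_ext fun i j p k l q => ?_
    by_cases h : j = k
    · subst h
      simp [c, vertexCoeff_comp]
    · simp [c, mulHom_of_ne p q h, vertexCoeff_mul_of_ne e p q h]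
  exact LinearMap.congr_fun₂ this x y

theorem lift_arrowCoeff_mul (a : Σ i j : Q, (i ⟶ j)) (x y : PathAlgebra K Q) :
    lift K (fun p => arrowCoeff K a p.2.2) (x * y) =
      lift K (fun p => vertexCoeff K a.1 p.2.2) x * lift K (fun p => arrowCoeff K a p.2.2) y +
      lift K (fun p => arrowCoeff K a p.2.2) x *
        lift K (fun p => vertexCoeff K a.2.1 p.2.2) y := by
  let c : PathAlgebra K Q →ₗ[K] K := lift K (fun p => arrowCoeff K a p.2.2)
  let s (e : Q) : PathAlgebra K Q →ₗ[K] K := lift K (fun p => vertexCoeff K e p.2.2)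
  have : (mulHom K).compr₂ c = (LinearMap.mul K K).compl₁₂ (s a.1) c +
      (LinearMap.mul K K).compl₁₂ c (s a.2.1) := by
    refine bilin_ext fun i j p k l q => ?_
    by_cases h : j = k
    · subst h
      simp [c, s, arrowCoeff_comp]
    · simp [c, s, mulHom_of_ne p q h, arrowCoeff_mul_of_ne a p q h]
  exact LinearMap.congr_fun₂ this x y

theorem lift_vertexCoeff_one (e : Q) :
    lift K (fun p => vertexCoeff K e p.2.2) (1 : PathAlgebra K Q) = 1 := by
  rw [one_def, map_sum, Finset.sum_eq_single e]
  · simp [vertex, vertexCoeff]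
  · intro i _ hi
    simp [vertex, vertexCoeff, hi]
  · simp

end Coefficients

end PathAlgebra

/-! ### Simple modules at the vertices and the absence of parallel arrows. -/

namespace IsAdmissiblePresentation

open PathAlgebra

variable {K : Type*} {Q : Type u} {A : Type w} [Field K] [Quiver.{v + 1} Q] [Fintype Q] [Ring A]
  [Algebra K A] {π : PathAlgebra K Q →ₐ[K] A}

/-- Since `I` lies in the square of the arrow ideal, a functional that kills all paths of length at
least two kills `I`. A linear section of `π` then serves to define it on `A`. -/
theorem exists_factor (hπ : IsAdmissiblePresentation π) {M : Type*} [AddCommGroup M] [Module K M]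
    (f : QPath Q → M) (hf : ∀ (i j : Q) (p : Quiver.Path i j), 2 ≤ p.length → f ⟨i, j, p⟩ = 0) :
    ∃ g : A →ₗ[K] M, ∀ x, g (π x) = PathAlgebra.lift K f x := by
  obtain ⟨s, hs⟩ := LinearMap.exists_rightInverse_of_surjective π.toLinearMap
    (LinearMap.range_eq_top.mpr hπ.surjective)
  have hs : ∀ y, π (s y) = y := LinearMap.congr_fun hs
  refine ⟨PathAlgebra.lift K f ∘ₗ s, fun x => ?_⟩
  rw [LinearMap.comp_apply, ← sub_eq_zero, ← map_sub]
  refine lift_eq_zero_of_mem_arrowIdealPow f hf (hπ.ker_le _ ?_)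
  rw [map_sub, hs, sub_self]

theorem exists_character (hπ : IsAdmissiblePresentation π) (e : Q) :
    ∃ χ : A →ₐ[K] K, ∀ x, χ (π x) = PathAlgebra.lift K (fun p => vertexCoeff K e p.2.2) x := by
  obtain ⟨g, hg⟩ := hπ.exists_factor (fun p => vertexCoeff K e p.2.2)
    fun i j p hp => vertexCoeff_eq_zero e p (by omega)
  refine ⟨AlgHom.ofLinearMap g ?_ ?_, hg⟩
  · rw [← map_one π, hg, lift_vertexCoeff_one]
  · intro x y
    obtain ⟨x, rfl⟩ := hπ.surjective x
    obtain ⟨y, rfl⟩ := hπ.surjective y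
    rw [← map_mul, hg, hg, hg, lift_vertexCoeff_mul]

/-- The coefficients of two distinct arrows from `i` to `j` are twisted derivations for the
characters at `i` and `j`, and they separate these arrows, on which both characters vanish. -/
theorem subsingleton_arrows (hπ : IsAdmissiblePresentation π)
    (hExt : ∀ S T : ModuleCat.{w} Aᵐᵒᵖ, IsSimpleModule Aᵐᵒᵖ S → IsSimpleModule Aᵐᵒᵖ T →
      Module.rank K (CategoryTheory.Abelian.Ext S T 1) ≤ 1) (i j : Q) :
    Subsingleton (i ⟶ j) := by
  refine ⟨fun a a' => by_contra fun hne => ?_⟩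
  obtain ⟨χ, hχ⟩ := hπ.exists_character i
  obtain ⟨χ', hχ'⟩ := hπ.exists_character j
  have hcoeff : ∀ d : i ⟶ j, ∃ c : A →ₗ[K] K, (∀ x y, c (x * y) = χ x * c y + c x * χ' y) ∧
      ∀ d' : i ⟶ j, c (π (arrow K d')) = arrowCoeff K ⟨i, j, d⟩ d'.toPath := by
    intro d
    obtain ⟨c, hc⟩ := hπ.exists_factor (fun p => arrowCoeff K ⟨i, j, d⟩ p.2.2)
      fun _ _ p hp => arrowCoeff_eq_zero _ p hp
    refine ⟨c, fun x y => ?_, fun d' => ?_⟩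
    · obtain ⟨x, rfl⟩ := hπ.surjective x
      obtain ⟨y, rfl⟩ := hπ.surjective y
      rw [← map_mul, hc, hc, hc, hχ, hχ', lift_arrowCoeff_mul]
    · rw [hc, arrow, lift_ofPath]
  obtain ⟨c, hc, hca⟩ := hcoeff a
  obtain ⟨c', hc', hca'⟩ := hcoeff a'
  refine one_lt_rank_ext_characterModule χ χ' c c' hc hc' (x := π (arrow K a))
    (x' := π (arrow K a')) ?_ ?_ ?_ ?_ ?_ ?_ ?_ ?_
    (hExt _ _ (isSimpleModule_characterModule χ) (isSimpleModule_characterModule χ'))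
  · rw [hχ, arrow, lift_ofPath]; rfl
  · rw [hχ, arrow, lift_ofPath]; rfl
  · rw [hχ', arrow, lift_ofPath]; rfl
  · rw [hχ', arrow, lift_ofPath]; rfl
  · simp [hca, arrowCoeff, Quiver.Hom.toPath]
  · simp [hca, arrowCoeff, Quiver.Hom.toPath, Ne.symm hne]
  · simp [hca', arrowCoeff, Quiver.Hom.toPath, hne]
  · simp [hca', arrowCoeff, Quiver.Hom.toPath]

end IsAdmissiblePresentation

/-! ## Derivations vanishing on the vertices -/

section Derivations

open PathAlgebra

attribute [local instance] LieRing.ofAssociativeRing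

variable {K : Type*} {Q : Type u} {A : Type*} [Field K] [Quiver.{v + 1} Q] [Fintype Q] [Ring A]
  [Algebra K A] (π : PathAlgebra K Q →ₐ[K] A)

/-! ### The filtration of `A` by powers of the arrow ideal. -/

/-- The image in `A` of the `n`-th power of the arrow ideal. -/
noncomputable def arrowImage (n : ℕ) : Submodule K A :=
  (arrowIdealPow K Q n).map π.toLinearMap

variable {π}

theorem ofPath_mem_arrowImage {n : ℕ} {i j : Q} (p : Quiver.Path i j) (h : n ≤ p.length) :
    π (ofPath K p) ∈ arrowImage π n :=
  ⟨ofPath K p, Submodule.subset_span ⟨i, j, p, h, rfl⟩, rfl⟩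

theorem arrowImage_le {n : ℕ} {W : Submodule K A}
    (h : ∀ (i j : Q) (p : Quiver.Path i j), n ≤ p.length → π (ofPath K p) ∈ W) :
    arrowImage π n ≤ W := by
  rw [arrowImage, arrowIdealPow, Submodule.map_span_le]
  rintro _ ⟨i, j, p, hp, rfl⟩
  exact h i j p hp

theorem arrowImage_anti {m n : ℕ} (h : m ≤ n) : arrowImage π n ≤ arrowImage π m :=
  arrowImage_le fun _ _ p hp => ofPath_mem_arrowImage p (h.trans hp)

theorem mul_mem_arrowImage {m n : ℕ} {x y : A} (hx : x ∈ arrowImage π m)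
    (hy : y ∈ arrowImage π n) : x * y ∈ arrowImage π (m + n) := by
  have h1 : ∀ (i j : Q) (p : Quiver.Path i j), m ≤ p.length → ∀ y ∈ arrowImage π n,
      π (ofPath K p) * y ∈ arrowImage π (m + n) := by
    intro i j p hp y hy
    have : arrowImage π n ≤
        (arrowImage π (m + n)).comap (LinearMap.mulLeft K (π (ofPath K p))) := by
      refine arrowImage_le fun k l q hq => ?_
      rw [Submodule.mem_comap, LinearMap.mulLeft_apply, ← map_mul]
      by_cases h : j = k
      · subst h
        rw [ofPath_mul_ofPath]
        exact ofPath_mem_arrowImage _ (by rw [Quiver.Path.length_comp]; omega)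
      · rw [ofPath_mul_of_ne _ _ h, map_zero]
        exact zero_mem _
    exact this hy
  have : arrowImage π m ≤ (arrowImage π (m + n)).comap (LinearMap.mulRight K y) :=
    arrowImage_le fun i j p hp => h1 i j p hp y hy
  exact this hx

theorem mem_arrowImage_zero (hπ : Function.Surjective π) (x : A) : x ∈ arrowImage π 0 := by
  have h : ∀ y : PathAlgebra K Q, π y ∈ arrowImage π 0 := by
    intro y
    have := hom_ext (K := K) (Q := Q) (f := (arrowImage π 0).mkQ ∘ₗ π.toLinearMap) (g := 0)
      fun i j p => by simpa using ofPath_mem_arrowImage p (Nat.zero_le _)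
    simpa using LinearMap.congr_fun this y
  obtain ⟨y, rfl⟩ := hπ x
  exact h y

theorem exists_arrowImage_eq_bot (hπ : IsAdmissiblePresentation π) :
    ∃ n, arrowImage π n = ⊥ := by
  obtain ⟨m, -, h⟩ := hπ.le_ker
  refine ⟨m, ?_⟩
  rw [eq_bot_iff]
  rintro _ ⟨x, hx, rfl⟩
  exact h x hx

/-! ### Peirce components -/

theorem ofPath_cons {i j k : Q} (p : Quiver.Path i j) (a : j ⟶ k) :
    ofPath K (p.cons a) = ofPath K p * arrow K a := by
  rw [arrow, ofPath_mul_ofPath]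
  rfl

theorem vertex_mul_ofPath {i j : Q} (p : Quiver.Path i j) :
    vertex K i * ofPath K p = ofPath K p := by
  rw [vertex, ofPath_mul_ofPath, Quiver.Path.nil_comp]

theorem ofPath_mul_vertex {i j : Q} (p : Quiver.Path i j) :
    ofPath K p * vertex K j = ofPath K p := by
  rw [vertex, ofPath_mul_ofPath, Quiver.Path.comp_nil]

theorem vertex_mul_vertex_of_ne {i j : Q} (h : i ≠ j) : vertex K i * vertex K j = 0 :=
  ofPath_mul_of_ne _ _ h

theorem sandwich_ofPath_eq_zero {i j k l : Q} (p : Quiver.Path k l) (h : i ≠ k ∨ l ≠ j) :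
    π (vertex K i) * π (ofPath K p) * π (vertex K j) = 0 := by
  rw [← map_mul, ← map_mul]
  rcases h with h | h
  · rw [vertex, ofPath_mul_of_ne _ _ h, zero_mul, map_zero]
  · rw [mul_assoc, vertex, vertex, ofPath_mul_of_ne _ _ h, mul_zero, map_zero]

theorem sandwich_ofPath {i j : Q} (p : Quiver.Path i j) :
    π (vertex K i) * π (ofPath K p) * π (vertex K j) = π (ofPath K p) := by
  rw [← map_mul, ← map_mul, vertex_mul_ofPath, ofPath_mul_vertex]

/-- If `a` is the only arrow from `i` to `j`, then the elements of `e_i J e_j` are multiples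
of `a` modulo `J²`. -/
theorem exists_sub_smul_arrow_mem {i j : Q} [Subsingleton (i ⟶ j)] (a : i ⟶ j) {x : A}
    (hx : x ∈ arrowImage π 1) (h : π (vertex K i) * x * π (vertex K j) = x) :
    ∃ c : K, x - c • π (arrow K a) ∈ arrowImage π 2 := by
  -- Multiplying by `e_i` and `e_j` kills every path that does not run from `i` to `j`; of the
  -- surviving paths of positive length, only `a` is shorter than two.
  have hle : arrowImage π 1 ≤ (Submodule.span K {π (arrow K a)} ⊔ arrowImage π 2).comap
      (LinearMap.mulRight K (π (vertex K j)) ∘ₗ LinearMap.mulLeft K (π (vertex K i))) := by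
    refine arrowImage_le fun k l p hp => ?_
    rw [Submodule.mem_comap, LinearMap.comp_apply, LinearMap.mulLeft_apply,
      LinearMap.mulRight_apply]
    by_cases hne : i ≠ k ∨ l ≠ j
    · rw [sandwich_ofPath_eq_zero p hne]
      exact zero_mem _
    · obtain ⟨rfl, rfl⟩ : i = k ∧ l = j := by simpa [not_or] using hne
      rw [sandwich_ofPath]
      by_cases hp2 : 2 ≤ p.length
      · exact Submodule.mem_sup_right (ofPath_mem_arrowImage p hp2)
      · cases p with
        | nil => simp at hp
        | cons p d =>
          have h0 : p.length = 0 := by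
            rw [Quiver.Path.length_cons] at hp2
            omega
          obtain rfl := Quiver.Path.eq_of_length_zero p h0
          obtain rfl := Quiver.Path.eq_nil_of_length_zero p h0
          rw [Subsingleton.elim d a]
          exact Submodule.mem_sup_left (Submodule.mem_span_singleton_self _)
  have hx' := hle hx
  rw [Submodule.mem_comap, LinearMap.comp_apply, LinearMap.mulLeft_apply,
    LinearMap.mulRight_apply, h] at hx'
  obtain ⟨y, hy, z, hz, hyz⟩ := Submodule.mem_sup.mp hx'
  obtain ⟨c, rfl⟩ := Submodule.mem_span_singleton.mp hy
  exact ⟨c, by rwa [← hyz, add_sub_cancel_left]⟩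

/-! ### The filtration of the derivations that vanish on the vertices -/

variable (π)

/-- The derivations of `A` that vanish on the vertices. -/
def vertexDer : LieSubalgebra K (algDer K A) where
  carrier := {D | ∀ i : Q, D.1 (π (vertex K i)) = 0}
  add_mem' := by
    intro D D' h h' i
    have : (D + D').1 (π (vertex K i)) = D.1 (π (vertex K i)) + D'.1 (π (vertex K i)) := rfl
    rw [this, h i, h' i, add_zero]
  zero_mem' := fun _ => rfl
  smul_mem' := by
    intro c D h i
    have : (c • D).1 (π (vertex K i)) = c • D.1 (π (vertex K i)) := rfl
    rw [this, h i, smul_zero]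
  lie_mem' := by
    intro D D' h h' i
    have : ⁅D, D'⁆.1 (π (vertex K i)) =
      D.1 (D'.1 (π (vertex K i))) - D'.1 (D.1 (π (vertex K i))) := rfl
    rw [this, h i, h' i, map_zero, map_zero, sub_zero]

variable {π}

theorem vertexDer_mul (D : vertexDer π) (x y : A) :
    D.1.1 (x * y) = D.1.1 x * y + x * D.1.1 y := D.1.2 x y

theorem vertexDer_sandwich (D : vertexDer π) (i j : Q) (x : A) :
    π (vertex K i) * D.1.1 x * π (vertex K j) =
      D.1.1 (π (vertex K i) * x * π (vertex K j)) := by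
  rw [vertexDer_mul, vertexDer_mul, D.2 i, D.2 j, zero_mul, zero_add, mul_zero, add_zero]

theorem vertexDer_arrow_sandwich (D : vertexDer π) {i j : Q} (a : i ⟶ j) :
    π (vertex K i) * D.1.1 (π (arrow K a)) * π (vertex K j) = D.1.1 (π (arrow K a)) := by
  rw [vertexDer_sandwich, arrow, sandwich_ofPath]

/-- The Leibniz rule replaces one arrow at a time, and each replacement raises the degree by `k`. -/
theorem vertexDer_ofPath_mem {D : vertexDer π} {k : ℕ}
    (h : ∀ (i j : Q) (a : i ⟶ j), D.1.1 (π (arrow K a)) ∈ arrowImage π (1 + k)) {i j : Q}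
    (p : Quiver.Path i j) : D.1.1 (π (ofPath K p)) ∈ arrowImage π (p.length + k) := by
  induction p with
  | nil =>
    have : D.1.1 (π (vertex K i)) = 0 := D.2 i
    rw [← vertex, this]
    exact zero_mem _
  | cons p a ih =>
    rw [ofPath_cons, map_mul, vertexDer_mul, Quiver.Path.length_cons]
    refine add_mem ?_ ?_
    · rw [add_right_comm]
      exact mul_mem_arrowImage ih (ofPath_mem_arrowImage _ le_rfl)
    · rw [add_assoc]
      exact mul_mem_arrowImage (ofPath_mem_arrowImage _ le_rfl) (h _ _ a)

theorem vertexDer_mem {D : vertexDer π} {k : ℕ}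
    (h : ∀ (i j : Q) (a : i ⟶ j), D.1.1 (π (arrow K a)) ∈ arrowImage π (1 + k)) {n : ℕ} {x : A}
    (hx : x ∈ arrowImage π n) : D.1.1 x ∈ arrowImage π (n + k) := by
  have : arrowImage π n ≤ (arrowImage π (n + k)).comap D.1.1 :=
    arrowImage_le fun i j p hp =>
      arrowImage_anti (Nat.add_le_add_right hp k) (vertexDer_ofPath_mem h p)
  exact this hx

variable (π) in
/-- The `k`-th step of the filtration of `vertexDer π`: derivations that send the arrows to
`J ^ (1 + k)`. -/
def vertexDerFiltration
    (h0 : ∀ (D : vertexDer π) (i j : Q) (a : i ⟶ j), D.1.1 (π (arrow K a)) ∈ arrowImage π 1)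
    (k : ℕ) : LieIdeal K (vertexDer π) where
  carrier := {D | ∀ (i j : Q) (a : i ⟶ j), D.1.1 (π (arrow K a)) ∈ arrowImage π (1 + k)}
  add_mem' := fun h h' i j a => add_mem (h i j a) (h' i j a)
  zero_mem' := fun _ _ _ => zero_mem _
  smul_mem' := fun c _ h i j a => Submodule.smul_mem _ c (h i j a)
  lie_mem := by
    intro D D' h i j a
    have e : ⁅D, D'⁆.1.1 (π (arrow K a)) =
      D.1.1 (D'.1.1 (π (arrow K a))) - D'.1.1 (D.1.1 (π (arrow K a))) := rfl
    rw [e]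
    exact sub_mem (vertexDer_mem (k := 0) (h0 D) (h i j a)) (vertexDer_mem h (h0 D i j a))

/-- Both derivations act on the arrow `a` modulo `J²` by scalars `c` and `c'`, and they preserve
`J²`; so the commutator acts by `c' * c - c * c' = 0`. -/
theorem vertexDer_lie_mem (hQ : ∀ i j : Q, Subsingleton (i ⟶ j)) {D D' : vertexDer π}
    (h : ∀ (i j : Q) (a : i ⟶ j), D.1.1 (π (arrow K a)) ∈ arrowImage π 1)
    (h' : ∀ (i j : Q) (a : i ⟶ j), D'.1.1 (π (arrow K a)) ∈ arrowImage π 1)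
    {i j : Q} (a : i ⟶ j) : ⁅D, D'⁆.1.1 (π (arrow K a)) ∈ arrowImage π 2 := by
  have e : ⁅D, D'⁆.1.1 (π (arrow K a)) =
    D.1.1 (D'.1.1 (π (arrow K a))) - D'.1.1 (D.1.1 (π (arrow K a))) := rfl
  have := hQ i j
  obtain ⟨c, hc⟩ := exists_sub_smul_arrow_mem a (h i j a) (vertexDer_arrow_sandwich D a)
  obtain ⟨c', hc'⟩ := exists_sub_smul_arrow_mem a (h' i j a) (vertexDer_arrow_sandwich D' a)
  have h1 := vertexDer_mem (k := 0) h hc'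
  have h2 := vertexDer_mem (k := 0) h' hc
  rw [map_sub, map_smul] at h1 h2
  -- `h1` and `h2` reduce the commutator modulo `J²` to `c' • D a - c • D' a`; the added terms
  -- replace `D a` and `D' a` by multiples of `a`, which cancel.
  have h3 := add_mem (sub_mem h1 h2) (sub_mem (Submodule.smul_mem _ c' hc)
    (Submodule.smul_mem _ c hc'))
  rw [e]
  convert h3 using 1
  simp only [smul_sub, smul_smul, mul_comm c' c]
  abel

theorem isSolvable_vertexDer (hπ : IsAdmissiblePresentation π)
    (hQ : ∀ i j : Q, Subsingleton (i ⟶ j))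
    (h0 : ∀ (D : vertexDer π) (i j : Q) (a : i ⟶ j), D.1.1 (π (arrow K a)) ∈ arrowImage π 1) :
    LieAlgebra.IsSolvable (vertexDer π) := by
  have hstep : ∀ k, LieAlgebra.derivedSeries K (vertexDer π) k ≤ vertexDerFiltration π h0 k := by
    intro k
    induction k with
    | zero => exact fun D _ => h0 D
    | succ k ih =>
      rw [LieAlgebra.derivedSeries, LieAlgebra.derivedSeriesOfIdeal_succ]
      refine (LieSubmodule.mono_lie ih ih).trans ?_
      rw [LieSubmodule.lie_le_iff]
      intro D hD D' hD' i j a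
      -- For `k ≥ 1` both composites send arrows to `J^(1+2k)`, and `1 + 2k ≥ 2 + k`; for `k = 0`
      -- degrees alone gain nothing and the scalar action is needed.
      rcases Nat.eq_zero_or_pos k with rfl | hk
      · exact vertexDer_lie_mem hQ hD hD' a
      · have e : ⁅D, D'⁆.1.1 (π (arrow K a)) =
          D.1.1 (D'.1.1 (π (arrow K a))) - D'.1.1 (D.1.1 (π (arrow K a))) := rfl
        rw [e]
        exact arrowImage_anti (by omega)
          (sub_mem (vertexDer_mem hD (hD' i j a)) (vertexDer_mem hD' (hD i j a)))
  obtain ⟨n, hn⟩ := exists_arrowImage_eq_bot hπ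
  rw [LieAlgebra.isSolvable_iff K]
  refine ⟨n, eq_bot_iff.mpr fun D hD => ?_⟩
  rw [LieSubmodule.mem_bot]
  refine Subtype.ext (Subtype.ext (LinearMap.ext fun x => ?_))
  -- A derivation in step `n` maps `A = J⁰` into `Jⁿ = 0`.
  have hx := vertexDer_mem (hstep n hD) (mem_arrowImage_zero hπ.surjective x)
  rw [zero_add, hn, Submodule.mem_bot] at hx
  exact hx

/-! ### Reduction to the vertices, and the role of `Σ₀(A)`. -/

/-- Every derivation is the sum of an inner derivation and one that vanishes on the vertices. -/
theorem exists_vertexDer_sub_mem_innerDer (D : algDer K A) :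
    ∃ D' ∈ vertexDer π, D - D' ∈ innerDer K A := by
  classical
  have hD : ∀ x y : A, D.1 (x * y) = D.1 x * y + x * D.1 y := D.2
  let e : Q → A := fun i => π (vertex K i)
  have hone : ∑ i, e i = 1 := by rw [← map_sum, ← one_def, map_one]
  have hmul : ∀ i j, e i * e j = if i = j then e i else 0 := by
    intro i j
    split_ifs with h
    · subst h
      rw [← map_mul]
      exact congrArg π (vertex_mul_ofPath _)
    · rw [← map_mul, vertex_mul_vertex_of_ne h, map_zero]
  -- Chosen so that `a * e j - e j * a = D (e j)`: differentiating `e j * e i` gives `e j * a = D (e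
  -- j) * e j - D (e j)`, while `a * e j = D (e j) * e j`.
  let a : A := ∑ i, D.1 (e i) * e i
  let ad : algDer K A := ⟨LinearMap.mulLeft K a - LinearMap.mulRight K a, fun x y => by
    simp only [LinearMap.sub_apply, LinearMap.mulLeft_apply, LinearMap.mulRight_apply]
    noncomm_ring⟩
  have had : ∀ x, ad.1 x = a * x - x * a := fun x => rfl
  refine ⟨D - ad, fun j => ?_, ⟨a, fun x => ?_⟩⟩
  · have h1 : (D - ad).1 (e j) = D.1 (e j) - (a * e j - e j * a) := rfl
    have h2 : a * e j = D.1 (e j) * e j := by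
      simp only [a, Finset.sum_mul, mul_assoc, hmul]
      simp
    have h3 : e j * a = D.1 (e j) * e j - D.1 (e j) := by
      have h4 : ∀ i, e j * (D.1 (e i) * e i) =
          (if j = i then D.1 (e j) * e j else 0) - D.1 (e j) * e i := by
        intro i
        have h5 := hD (e j) (e i)
        have h6 : e j * D.1 (e i) = D.1 (e j * e i) - D.1 (e j) * e i := by
          rw [h5, add_sub_cancel_left]
        rw [← mul_assoc, h6, sub_mul, mul_assoc (D.1 (e j)), hmul i i, if_pos rfl, hmul]
        split_ifs with h
        · rw [h]
        · rw [map_zero, zero_mul]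
      simp only [a, Finset.mul_sum, h4, Finset.sum_sub_distrib]
      rw [← Finset.mul_sum, hone, mul_one]
      simp
    change (D - ad).1 (e j) = 0
    rw [h1, h2, h3]
    abel
  · rw [sub_sub_cancel, had]

theorem isSolvable_hochschildOne (h : LieAlgebra.IsSolvable (vertexDer π)) :
    LieAlgebra.IsSolvable (HochschildOne K A) := by
  let f : vertexDer π →ₗ⁅K⁆ HochschildOne K A :=
    { toFun := fun D => (LieSubmodule.Quotient.mk D.1 : algDer K A ⧸ innerDer K A)
      map_add' := fun _ _ => rfl
      map_smul' := fun _ _ => rfl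
      map_lie' := fun {_ _} => rfl }
  have hf : Function.Surjective f := by
    intro x
    obtain ⟨D, hD⟩ := LieSubmodule.Quotient.surjective_mk' (innerDer K A) x
    obtain ⟨D', hD', hsub⟩ := exists_vertexDer_sub_mem_innerDer (π := π) D
    refine ⟨⟨D', hD'⟩, Eq.trans ?_ hD⟩
    have := (LieSubmodule.Quotient.mk_eq_zero (N := innerDer K A)).mpr hsub
    rw [map_sub, sub_eq_zero] at this
    exact this.symm
  exact hf.lieAlgebra_isSolvable

/-- If `Σ₀(A)` is empty, then the derivations vanishing on the vertices map arrows to `J`. -/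
theorem vertexDer_arrow_mem {B : Set (QPath Q)} (b : PathBasis π B) (hSigma : SigmaSet π b 0 = ∅)
    (D : vertexDer π) (i j : Q) (a : i ⟶ j) : D.1.1 (π (arrow K a)) ∈ arrowImage π 1 := by
  let f : ∀ ⦃i j : Q⦄, (i ⟶ j) → A := fun _ _ a => D.1.1 (π (arrow K a))
  -- Replacing arrows one by one computes `D` on paths, so `deltaOne π f` factors through `π` and
  -- kills the relations.
  have hδ : deltaOne π f = D.1.1 ∘ₗ π.toLinearMap := by
    refine hom_ext fun i j p => ?_
    rw [deltaOne, lift_ofPath]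
    change replaceOnPath π f p = D.1.1 (π (ofPath K p))
    induction p with
    | nil => exact (D.2 i).symm
    | cons p a ih =>
      rw [ofPath_cons, map_mul, vertexDer_mul, replaceOnPath, ih]
  have hf : IsOneCocycle π f := by
    refine ⟨fun i j a => vertexDer_arrow_sandwich D a, fun r hr => ?_⟩
    rw [hδ, LinearMap.comp_apply, AlgHom.toLinearMap_apply, hr, map_zero]
  have hsum := b.basis.linearCombination_repr (f a)
  have hfa : π (vertex K i) * f a * π (vertex K j) = f a := hf.1 i j a
  change f a ∈ _
  -- After sandwiching the expansion in `B`, only paths from `i` to `j` remain. One of length zero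
  -- would, with a nonzero coefficient, put a pair into `Σ₀(A)`; the others lie in `J`.
  rw [← hfa, ← hsum, Finsupp.linearCombination_apply, Finsupp.sum, Finset.mul_sum,
    Finset.sum_mul]
  refine sum_mem fun p _ => ?_
  rw [b.basis_apply, mul_smul_comm, smul_mul_assoc]
  obtain ⟨⟨k, l, p⟩, hp⟩ := p
  by_cases hne : i ≠ k ∨ l ≠ j
  · rw [sandwich_ofPath_eq_zero p hne, smul_zero]
    exact zero_mem _
  · obtain ⟨rfl, rfl⟩ : i = k ∧ l = j := by simpa [not_or] using hne
    rw [sandwich_ofPath]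
    by_cases hlen : p.length = 0
    · have hzero : b.basis.repr (f a) ⟨⟨i, l, p⟩, hp⟩ = 0 := by
        by_contra hne
        have : (⟨i, l, a, p⟩ : Σ i j : Q, (i ⟶ j) × Quiver.Path i j) ∈ SigmaSet π b 0 :=
          ⟨hlen, hp, f, hf, hne⟩
        rw [hSigma] at this
        exact this
      rw [hzero, zero_smul]
      exact zero_mem _
    · exact Submodule.smul_mem _ _ (ofPath_mem_arrowImage p (by omega))

end Derivations

theorem theorem1p2 {K : Type*} [Field K] [IsAlgClosed K]
    {Q : Type u} [Quiver.{v + 1} Q] [Fintype Q]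
    {A : Type w} [Ring A] [Algebra K A] [FiniteDimensional K A]
    (π : PathAlgebra K Q →ₐ[K] A) (hπ : IsAdmissiblePresentation π)
    (hExt : ∀ S T : ModuleCat.{w} Aᵐᵒᵖ, IsSimpleModule Aᵐᵒᵖ S → IsSimpleModule Aᵐᵒᵖ T →
      Module.rank K (CategoryTheory.Abelian.Ext S T 1) ≤ 1)
    (B : Set (QPath Q)) (b : PathBasis π B) (hSigma : SigmaSet π b 0 = ∅) :
    LieAlgebra.IsSolvable (HochschildOne K A) := by
  exact isSolvable_hochschildOne (isSolvable_vertexDer hπ (hπ.subsingleton_arrows hExt)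
    (vertexDer_arrow_mem b hSigma))
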